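/- Let $\mathbb{F}$ be an algebraically closed field of characteristic $0$. Let $P(z)\in\mathbb{F}[z]^{m\times n}$ be a (possibly singular or rectangular) matrix polynomial of grade $k\ge 2$, i.e. all entries of $P(z)$ have degree at most $k$. Let $0\neq\omega=(\omega_1,\dots,\omega_k)^T\in\mathbb{F}^k$ and let $v(z)=\omega_1z^{k-1}+\omega_2z^{k-2}+\dots+\omega_k$, a nonzero scalar polynomial of grade $k-1$. Let $L(z)=\mathbb{DL}(P,v)\in\mathbb{F}[z]^{km\times kn}$ be the $k\times k$ block pencil whose $m\times n$ blocks $L_{ij}(z)$, $1\le i,j\le k$, are determined by $$\sum_{i,j=1}^{k} y^{k-i}x^{k-j}L_{ij}(z)=\frac{P(y)(x-z)v(x)-P(x)(y-z)v(y)}{x-y}.$$ An element $\lambda\in\mathbb{F}$ is an eigenvalue of $P$ if $\operatorname{rank}P(\lambda)<\operatorname{rank}_{\mathbb{F}(z)}P(z)$, and $\infty$ is an eigenvalue of $P$ if $0$ is an eigenvalue of $z^kP(1/z)$; likewise $\infty$ is a root of $v$ if $0$ is a root of $z^{k-1}v(1/z)$. Suppose that the set of eigenvalues of $P$ and the set of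 roots of $v$, both as subsets of $\mathbb{F}\cup\{\infty\}$, are disjoint. A minimal basis of a matrix polynomial $A(z)\in\mathbb{F}[z]^{r\times s}$ is a polynomial matrix whose columns form a basis of $\{x\in\mathbb{F}(z)^s: A(z)x=0\}$ over $\mathbb{F}(z)$ such that the sum of the degrees of the columns is minimal among all bases consisting of polynomial vectors. Let $N(z)$ be any minimal basis of $L(z)$ and let $\widehat M(z)=(\omega^T\otimes I_n)N(z)$. After a permutation of columns write $\widehat M(z)=[\,M_d(z)\;\;M_c\,]$, where no column of $M_d(z)$ is constant in $z$ and $M_c$ is constant. Then: 1. For every constant matrix $M_b$ whose columns form a basis of the $\mathbb{F}$-span of the columns of $M_c$, the matrix $[\,M_d(z)\;\;M_b\,]$ is a minimal basis of $P(z)$ (if $M_c=0$, then $M_b$ has no columns and this matrix is $M_d(z)$). 2. $M_d(z)$ is a minimal basis of $P(z)$ if and only if $M_c=0$. -/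

import Mathlib

open Polynomial
open scoped Kronecker OnePoint

noncomputable section

namespace DLRecovery

variable {F : Type*} [Field F]

/-! ### Matrix polynomials -/

/-- A matrix polynomial seen as a matrix over the field `F(z)` of rational functions. -/
def toRat {ι κ : Type*} (P : Matrix ι κ F[X]) : Matrix ι κ (RatFunc F) :=
  P.map (algebraMap F[X] (RatFunc F))

/-- The constant matrix `P(a)`. -/
def evalAt {ι κ : Type*} (P : Matrix ι κ F[X]) (a : F) : Matrix ι κ F :=
  P.map (Polynomial.eval a)

/-- A constant matrix seen as a matrix polynomial. -/
def constPoly {ι κ : Type*} (A : Matrix ι κ F) : Matrix ι κ F[X] :=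
  A.map Polynomial.C

/-- `P` has grade `k`: all its entries have degree at most `k`. -/
def HasGrade {ι κ : Type*} (k : ℕ) (P : Matrix ι κ F[X]) : Prop :=
  ∀ i j, (P i j).natDegree ≤ k

/-- The normal rank: the rank over `F(z)`. -/
def normalRank {ι κ : Type*} [Fintype κ] (P : Matrix ι κ F[X]) : ℕ :=
  (toRat P).rank

/-- `a` is a finite eigenvalue of `P`: `rank P(a) < rank P(z)`. -/
def IsFiniteEigenvalue {ι κ : Type*} [Fintype κ] (P : Matrix ι κ F[X]) (a : F) : Prop :=
  (evalAt P a).rank < normalRank P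

/-- The reversal `z ^ k * P(1/z)` of a matrix polynomial of grade `k`. -/
def rev {ι κ : Type*} (k : ℕ) (P : Matrix ι κ F[X]) : Matrix ι κ F[X] :=
  P.map (Polynomial.reflect k)

/-- The eigenvalues, in `F ∪ {∞}`, of a matrix polynomial of grade `k`; `∞` is an eigenvalue
when `0` is an eigenvalue of the reversal with respect to the grade. -/
def eigenvalues {ι κ : Type*} [Fintype κ] (k : ℕ) (P : Matrix ι κ F[X]) : Set (OnePoint F) :=
  {μ | (∃ a : F, μ = (a : OnePoint F) ∧ IsFiniteEigenvalue P a) ∨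
    (μ = ∞ ∧ IsFiniteEigenvalue (rev k P) 0)}

/-- The roots, in `F ∪ {∞}`, of a scalar polynomial of grade `g`; `∞` is a root when `0` is
a root of the reversal with respect to the grade. -/
def gradedRoots (g : ℕ) (v : F[X]) : Set (OnePoint F) :=
  {μ | (∃ a : F, μ = (a : OnePoint F) ∧ v.IsRoot a) ∨ (μ = ∞ ∧ (v.reflect g).IsRoot 0)}

/-! ### Minimal bases -/

/-- The right kernel of `P` over `F(z)`. -/
def ratKer {ι κ : Type*} [Fintype κ] (P : Matrix ι κ F[X]) :
    Submodule (RatFunc F) (κ → RatFunc F) :=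
  LinearMap.ker (toRat P).mulVecLin

/-- The columns of the polynomial matrix `A` form a basis of the right kernel of `P`. -/
def IsPolyBasis {ι κ τ : Type*} [Fintype κ] (P : Matrix ι κ F[X]) (A : Matrix κ τ F[X]) : Prop :=
  LinearIndependent (RatFunc F) (toRat A).col ∧
    Submodule.span (RatFunc F) (Set.range (toRat A).col) = ratKer P

/-- The degree of the `j`-th column. -/
def colDegree {κ τ : Type*} [Fintype κ] (A : Matrix κ τ F[X]) (j : τ) : ℕ :=
  Finset.univ.sup fun i => (A i j).natDegree

/-- The columns of `A` form a right minimal basis of `P`: a polynomial basis of the right kernel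
whose sum of degrees is minimal among all polynomial bases. (All bases have the same number of
vectors, so it suffices to compare with bases indexed by the same type.) -/
def IsMinimalBasis {ι κ τ : Type*} [Fintype κ] [Fintype τ]
    (P : Matrix ι κ F[X]) (A : Matrix κ τ F[X]) : Prop :=
  IsPolyBasis P A ∧
    ∀ B : Matrix κ τ F[X], IsPolyBasis P B → ∑ j, colDegree A j ≤ ∑ j, colDegree B j

/-! ### The pencil `DL(P, v)` -/

/-- The Vandermonde vector `(z ^ (k-1), …, z, 1)`. -/
def vandermondeVec (k : ℕ) : Fin k → F[X] :=
  fun r => X ^ (k - 1 - (r : ℕ))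

/-- The ansatz polynomial `v(z) = ω₁ z ^ (k-1) + ⋯ + ω_k` of the ansatz vector `ω`. -/
def ansatzPoly {k : ℕ} (ω : Fin k → F) : F[X] :=
  ∑ r, C (ω r) * vandermondeVec k r

/-- `P(y) (x - z) v(x) - P(x) (y - z) v(y)` for a scalar polynomial `P`, as an element of
`R[z][y][x]`: here `x = X`, `y = C X` and `z = C (C X)`. -/
def bezoutNum {R : Type*} [CommRing R] (p v : R[X]) : R[X][X][X] :=
  aeval (C X : R[X][X][X]) p * (X - C (C X)) * aeval (X : R[X][X][X]) v -
    aeval (X : R[X][X][X]) p * (C X - C (C X)) * aeval (C X : R[X][X][X]) v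

/-- The Bézoutian `(P(y) (x - z) v(x) - P(x) (y - z) v(y)) / (x - y)` in `R[z][y][x]`, for one
entry of the matrix polynomial. -/
def bezout {R : Type*} [CommRing R] (p v : R[X]) : R[X][X][X] :=
  bezoutNum p v /ₘ (X - C X)

/-- The pencil `DL(P, v)`: the `k × k` block matrix whose block in (zero-based) position `(r, c)`
is the coefficient of `y ^ (k-1-r) x ^ (k-1-c)` in the Bézoutian. The index `(r, s)` is row `s`
of the `r`-th block row, and similarly for columns. -/
def DL {m n : ℕ} (k : ℕ) (P : Matrix (Fin m) (Fin n) F[X]) (v : F[X]) :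
    Matrix (Fin k × Fin m) (Fin k × Fin n) F[X] :=
  Matrix.of fun a b =>
    ((bezout (P a.2 b.2) v).coeff (k - 1 - (b.1 : ℕ))).coeff (k - 1 - (a.1 : ℕ))

/-- The constant `n × kn` matrix `ωᵀ ⊗ I_n`. -/
def ansatzRow {k : ℕ} (ω : Fin k → F) (n : ℕ) : Matrix (Fin n) (Fin k × Fin n) F :=
  (Matrix.replicateRow (Fin 1) ω ⊗ₖ (1 : Matrix (Fin n) (Fin n) F)).submatrix (fun i => (0, i)) id

/-- The division in the definition of the Bézoutian is exact. -/
theorem sub_mul_bezout {R : Type*} [CommRing R] (p v : R[X]) : (X - C X) * bezout p v = bezoutNum p v := by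
  have h : (bezoutNum p v).IsRoot (X : R[X][X]) := by
    have h1 : ∀ q : R[X], (aeval (X : R[X][X][X]) q).eval (X : R[X][X]) = aeval X q := by
      intro q
      rw [aeval_def, aeval_def, ← coe_evalRingHom, hom_eval₂]
      congr 1
      · ext; simp [Polynomial.algebraMap_apply]
      · simp
    have h2 : ∀ q : R[X], (aeval (C X : R[X][X][X]) q).eval (X : R[X][X]) = aeval X q := by
      intro q
      rw [aeval_def, aeval_def, ← coe_evalRingHom, hom_eval₂]
      congr 1
      · ext; simp [Polynomial.algebraMap_apply]
      · simp
    simp only [IsRoot, bezoutNum, eval_sub, eval_mul, h1, h2, eval_X, eval_C]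
    ring
  exact mul_divByMonic_eq_iff_isRoot.mpr h

end DLRecovery

end

/-!
Write `Φ = ωᵀ ⊗ I_n` and `L = DL(P, v)`, and view a block vector `u` over `F(z)` as a linear functional
`φ` on polynomials in `x` of degree less than `k`, so that `Φ u = φ(v)`. Since `x - z = (x - y) + (y - z)`,
the Bézoutian equals `P(y) v(x) + (y - z) b(x, y)` with `b = (P(y) v(x) - P(x) v(y)) / (x - y)` free
of `z` (`bezout_eq`). Three facts follow.

* Setting `y = z` shows that `Φ` maps `ker L` into `ker P` (`ansatzRow_mulVec_mem_ratKer`).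
* A vector of `ker L` killed by `Φ` is killed by the constant matrix of `b`; hence `ker L ∩ ker Φ` is
  spanned by constant vectors (`mem_span_constants`).
* A polynomial vector `f` in `ker P` lifts to a polynomial vector of `ker L` of no larger degree
  (`exists_lift`). The lift is the functional `q ↦ Res (q(x) f(x) / ((x - z) v(x)))`, with the expansion
  of `1 / (x - z)` at infinity cut off at the degree of `f`.

Lifting a polynomial basis `B` of `P` and adding constants from `ker L ∩ ker Φ` gives a polynomial
basis of `L`, so a minimal basis `N` of `L` has degree sum at most that of `B`
(`sum_colDegree_pencil_le`). As `Φ` is constant, the degree sum of the nonconstant columns `M_d` of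
`Φ N` is then also at most that of any polynomial basis of `P`. The columns of `[M_d M_b]` span `ker P`
because `Φ` maps `ker L` onto `ker P`. They are independent because otherwise `M_b` could be completed
to a basis by a proper subset of the columns of `M_d`, all of which have positive degree, giving a
basis with too small a degree sum (`isPolyBasis_fromCols`).
-/

noncomputable section

namespace DLRecovery

variable {F : Type*} [Field F]

/-! ### The core of the Bézoutian -/

/-- `p(y) v(x) - p(x) v(y)` is divisible by `x - y`; here `x = X` and `y = C X`. -/
theorem exists_core (p v : F[X]) :
    ∃ b : F[X][X], (X - C X) * b = C p * v.map C - p.map C * C v := by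
  have h : X - C X ∣ C p * v.map C - p.map C * C v := by
    rw [dvd_iff_isRoot]
    have (q : F[X]) : (q.map C).eval X = q := by rw [eval_map, eval₂_C_X]
    simp [this, mul_comm]
  exact h.imp fun _ h => h.symm

/-- The classical Bézoutian `(p(y) v(x) - p(x) v(y)) / (x - y)`, which does not involve `z`, in `F[y][x]`:
the outer variable is `x` and the inner one is `y`. -/
def core (p v : F[X]) : F[X][X] := (exists_core p v).choose

theorem sub_mul_core (p v : F[X]) : (X - C X) * core p v = C p * v.map C - p.map C * C v :=
  (exists_core p v).choose_spec

/-- The coefficient of `y ^ (i - 1)` in `core p v`, as a polynomial in `x`, with value `0` at `i = 0`.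
The shift by one lets the coefficients of both `core p v` and `y * core p v` be written without
natural-number subtraction. -/
def coreRow (p v : F[X]) : ℕ → F[X]
  | 0 => 0
  | i + 1 => ∑ l ∈ Finset.range ((core p v).natDegree + 1), C (((core p v).coeff l).coeff i) * X ^ l

@[simp] theorem coreRow_zero (p v : F[X]) : coreRow p v 0 = 0 := rfl

theorem coeff_coreRow_succ (p v : F[X]) (i l : ℕ) :
    (coreRow p v (i + 1)).coeff l = ((core p v).coeff l).coeff i := by
  simp only [coreRow, finsetSum_coeff, coeff_C_mul_X_pow, Finset.sum_ite_eq, Finset.mem_range]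
  split_ifs with h
  · rfl
  · rw [coeff_eq_zero_of_natDegree_lt (show (core p v).natDegree < l by omega), coeff_zero]

/-- The defining equation `(x - y) * core p v = p(y) v(x) - p(x) v(y)`, read off at `y ^ i`. -/
theorem X_mul_coreRow_succ (p v : F[X]) (i : ℕ) :
    X * coreRow p v (i + 1) = coreRow p v i + C (p.coeff i) * v - C (v.coeff i) * p := by
  ext l
  have h := congrArg (fun q => (q.coeff l).coeff i) (sub_mul_core p v)
  rcases l with _ | l <;> rcases i with _ | i <;>
    simp [sub_mul, coeff_X_mul, coeff_C_mul, coeff_map, coeff_mul_C, coeff_coreRow_succ,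
      mul_coeff_zero] at h ⊢
  · ring
  all_goals linear_combination h

/-- The core has degree less than `k` in `x`. -/
theorem coreRow_coeff_eq_zero {k : ℕ} {p v : F[X]} (hp : p.natDegree ≤ k) (hv : v.natDegree < k)
    (i : ℕ) {l : ℕ} (hl : k ≤ l) : (coreRow p v i).coeff l = 0 := by
  induction i generalizing l with
  | zero => simp
  | succ i ih =>
    have h := congrArg (fun q => q.coeff (l + 1)) (X_mul_coreRow_succ p v i)
    simpa [coeff_X_mul, ih (show k ≤ l + 1 by omega),
      coeff_eq_zero_of_natDegree_lt (show p.natDegree < l + 1 by omega),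
      coeff_eq_zero_of_natDegree_lt (show v.natDegree < l + 1 by omega)] using h

/-- The core has degree less than `k` in `y`. -/
theorem coreRow_eq_zero {k : ℕ} {p v : F[X]} (hp : p.natDegree ≤ k) (hv : v.natDegree < k)
    {i : ℕ} (hi : k < i) : coreRow p v i = 0 := by
  ext l
  induction l generalizing i with
  | zero =>
    have h := congrArg (fun q => q.coeff 0) (X_mul_coreRow_succ p v i)
    simpa [coeff_eq_zero_of_natDegree_lt (show p.natDegree < i by omega),
      coeff_eq_zero_of_natDegree_lt (show v.natDegree < i by omega)] using h.symm
  | succ l ih =>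
    have h := congrArg (fun q => q.coeff (l + 1)) (X_mul_coreRow_succ p v i)
    rw [coeff_X_mul, ih (by omega)] at h
    simpa [coeff_eq_zero_of_natDegree_lt (show p.natDegree < i by omega),
      coeff_eq_zero_of_natDegree_lt (show v.natDegree < i by omega)] using h.symm

/-- The Bézoutian defining the pencil is `p(y) v(x) + (y - z) * core p v`: write `x - z` as
`(x - y) + (y - z)` in the numerator. -/
theorem bezout_eq (p v : F[X]) :
    bezout p v = C (p.map C) * v.map (C.comp C) +
      (C X - C (C X)) * (core p v).map (mapRingHom C) := by
  have h1 (q : F[X]) : aeval (X : F[X][X][X]) q = q.map (C.comp C) := by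
    induction q using Polynomial.induction_on' with
    | add a b ha hb => simp [ha, hb]
    | monomial n a => simp [← C_mul_X_pow_eq_monomial, Polynomial.algebraMap_apply]
  have h2 (q : F[X]) : aeval (C X : F[X][X][X]) q = C (q.map C) := by
    induction q using Polynomial.induction_on' with
    | add a b ha hb => simp [ha, hb]
    | monomial n a => simp [← C_mul_X_pow_eq_monomial, Polynomial.algebraMap_apply]
  have hc : (mapRingHom (C : F →+* F[X])).comp C = C.comp C := by ext; simp
  have h3 := congrArg (Polynomial.map (mapRingHom (C : F →+* F[X]))) (sub_mul_core p v)
  simp only [Polynomial.map_mul, Polynomial.map_sub, map_X, map_C, coe_mapRingHom,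
    Polynomial.map_map, hc] at h3
  apply (monic_X_sub_C (X : F[X][X])).isRegular.left
  change (X - C X) * _ = (X - C X) * _
  rw [sub_mul_bezout, bezoutNum, h1, h1, h2, h2]
  linear_combination -(C X - C (C X)) * h3

/-- The coefficient of `y ^ i x ^ l` in the Bézoutian; here `z = X`. -/
theorem coeff_coeff_bezout (p v : F[X]) (i l : ℕ) :
    ((bezout p v).coeff l).coeff i =
      C (p.coeff i * v.coeff l + (coreRow p v i).coeff l) -
        X * C ((coreRow p v (i + 1)).coeff l) := by
  rw [bezout_eq, ← C_sub, coeff_add, coeff_C_mul, coeff_C_mul, sub_mul, coeff_add, coeff_sub,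
    coeff_map, coeff_map, coeff_C_mul]
  rcases i with _ | i <;>
    simp [coeff_coreRow_succ, mul_coeff_zero] <;> ring

/-! ### Pairing polynomials with block vectors -/

/-- A block vector `u = (u_1, …, u_k)` seen as a linear functional on polynomials in `x` of degree
less than `k`: it sends `x ^ (k - c)` to `u_c`, in the one-based numbering of the blocks. Coefficients
of `q` of degree `k` and higher are ignored. -/
def pair {M : Type*} [AddCommGroup M] [Module F M] {k : ℕ} (q : F[X]) (u : Fin k → M) : M :=
  ∑ c : Fin k, q.coeff (k - 1 - (c : ℕ)) • u c

section pair

variable {M M' : Type*} [AddCommGroup M] [Module F M] [AddCommGroup M'] [Module F M'] {k : ℕ}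

@[simp] theorem pair_zero_left (u : Fin k → M) : pair (0 : F[X]) u = 0 := by simp [pair]

theorem pair_add_left (p q : F[X]) (u : Fin k → M) : pair (p + q) u = pair p u + pair q u := by
  simp [pair, add_smul, Finset.sum_add_distrib]

theorem pair_C_mul_left (a : F) (q : F[X]) (u : Fin k → M) : pair (C a * q) u = a • pair q u := by
  simp [pair, Finset.smul_sum, mul_smul]

theorem map_pair (f : M →ₗ[F] M') (q : F[X]) (u : Fin k → M) :
    f (pair q u) = pair q (fun c => f (u c)) := by
  simp [pair]

end pair

theorem coeff_ansatzPoly {k : ℕ} (ω : Fin k → F) (c : Fin k) :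
    (ansatzPoly ω).coeff (k - 1 - (c : ℕ)) = ω c := by
  simp only [ansatzPoly, vandermondeVec, finsetSum_coeff, coeff_C_mul_X_pow]
  rw [Finset.sum_eq_single c]
  · simp
  · intro b _ hb
    rw [if_neg]
    have := b.2; have := c.2
    intro h; apply hb; ext; omega
  · simp

theorem natDegree_ansatzPoly_lt {k : ℕ} (hk : 0 < k) (ω : Fin k → F) :
    (ansatzPoly ω).natDegree < k := by
  have : (ansatzPoly ω).natDegree ≤ k - 1 := by
    refine natDegree_sum_le_of_forall_le _ _ fun r _ => ?_
    exact (natDegree_C_mul_X_pow_le _ _).trans (by omega)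
  omega

theorem ansatzPoly_ne_zero {k : ℕ} {ω : Fin k → F} (hω : ω ≠ 0) : ansatzPoly ω ≠ 0 := by
  contrapose! hω
  ext c
  rw [← coeff_ansatzPoly ω c, hω]; simp

theorem ansatzRow_mulVec {k n : ℕ} (ω : Fin k → F) (u : Fin k × Fin n → RatFunc F) (b : Fin n) :
    (toRat (constPoly (ansatzRow ω n))).mulVec u b = pair (ansatzPoly ω) (fun c => u (c, b)) := by
  simp only [Matrix.mulVec, dotProduct, toRat, constPoly, ansatzRow, pair, Fintype.sum_prod_type,
    coeff_ansatzPoly, Algebra.smul_def]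
  refine Finset.sum_congr rfl fun c _ => ?_
  rw [Finset.sum_eq_single b]
  · simp [RatFunc.algebraMap_eq_C]
  · intro x _ hx
    simp [hx.symm]
  · simp

/-! ### The pencil acting on block vectors -/

/-- The entries of `L u` for the pencil `L = DL(P, v)`, where `i` is the power of `y` that labels the
block row and `a` is the row within it. It is defined for every `i`, and `u` and `z` may live in any
`F`-algebra, so that it applies to polynomial and to rational vectors. -/
def rowAct {m n k : ℕ} (P : Matrix (Fin m) (Fin n) F[X]) (v : F[X])
    {A : Type*} [CommRing A] [Algebra F A] (z : A) (u : Fin k × Fin n → A) (i : ℕ) (a : Fin m) : A :=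
  ∑ b, ((P a b).coeff i • pair v (fun c => u (c, b)) +
    pair (coreRow (P a b) v i) (fun c => u (c, b)) -
      z * pair (coreRow (P a b) v (i + 1)) (fun c => u (c, b)))

theorem DL_mulVec {m n k : ℕ} (P : Matrix (Fin m) (Fin n) F[X]) (v : F[X])
    (u : Fin k × Fin n → RatFunc F) (r : Fin k) (a : Fin m) :
    (toRat (DL k P v)).mulVec u (r, a) = rowAct P v RatFunc.X u (k - 1 - r) a := by
  simp only [Matrix.mulVec, dotProduct, toRat, DL, Matrix.map_apply, Matrix.of_apply,
    Fintype.sum_prod_type_right, rowAct, pair, coeff_coeff_bezout]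
  refine Finset.sum_congr rfl fun b _ => ?_
  rw [Finset.smul_sum, Finset.mul_sum, ← Finset.sum_add_distrib, ← Finset.sum_sub_distrib]
  refine Finset.sum_congr rfl fun c _ => ?_
  simp only [Algebra.smul_def, map_sub, map_mul, map_add, RatFunc.algebraMap_C,
    RatFunc.algebraMap_X, RatFunc.algebraMap_eq_C]
  ring

theorem mem_ratKer_DL {m n k : ℕ} {P : Matrix (Fin m) (Fin n) F[X]} {v : F[X]}
    {u : Fin k × Fin n → RatFunc F} :
    u ∈ ratKer (DL k P v) ↔ ∀ i < k, ∀ a, rowAct P v RatFunc.X u i a = 0 := by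
  simp only [ratKer, LinearMap.mem_ker, Matrix.mulVecLin_apply, funext_iff, Prod.forall, DL_mulVec,
    Pi.zero_apply]
  constructor
  · intro h i hi a
    simpa [show k - 1 - (k - 1 - i) = i by omega] using h ⟨k - 1 - i, by omega⟩ a
  · intro h r a
    exact h _ (by omega) a

/-- The coefficient of `y ^ k` in the Bézoutian vanishes. -/
theorem coreRow_add_eq_zero {k : ℕ} {p v : F[X]} (hp : p.natDegree ≤ k) (hv : v.natDegree < k) :
    coreRow p v k + C (p.coeff k) * v = 0 := by
  have h := X_mul_coreRow_succ p v k
  rw [coreRow_eq_zero hp hv (Nat.lt_succ_self k), coeff_eq_zero_of_natDegree_lt hv] at h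
  simpa using h.symm

theorem algebraMap_ratFunc_eq_sum {k : ℕ} {p : F[X]} (hp : p.natDegree ≤ k) :
    algebraMap F[X] (RatFunc F) p =
      ∑ i ∈ Finset.range (k + 1), (RatFunc.X : RatFunc F) ^ i * algebraMap F _ (p.coeff i) := by
  conv_lhs => rw [as_sum_range_C_mul_X_pow' p (Nat.lt_succ_of_le hp)]
  simp only [map_sum, map_mul, map_pow, RatFunc.algebraMap_X, RatFunc.algebraMap_C,
    RatFunc.algebraMap_eq_C, mul_comm]

/-- The ansatz map `ωᵀ ⊗ I_n` sends the kernel of the pencil into that of `P`. Multiplying the row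
labelled `y ^ i` by `z ^ i` and adding up amounts to setting `y = z` in the Bézoutian, which leaves
`P(z) v(x)`. -/
theorem ansatzRow_mulVec_mem_ratKer {m n k : ℕ} (hk : 0 < k) {P : Matrix (Fin m) (Fin n) F[X]}
    (hP : HasGrade k P) (ω : Fin k → F) {u : Fin k × Fin n → RatFunc F}
    (hu : u ∈ ratKer (DL k P (ansatzPoly ω))) :
    (toRat (constPoly (ansatzRow ω n))).mulVec u ∈ ratKer P := by
  set v := ansatzPoly ω with hv
  have hvk : v.natDegree < k := natDegree_ansatzPoly_lt hk ω
  rw [mem_ratKer_DL] at hu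
  simp only [ratKer, LinearMap.mem_ker, Matrix.mulVecLin_apply]
  ext a
  -- The sum runs up to `i = k`, so that it reaches the leading coefficient of `P`.
  have hall : ∀ i ∈ Finset.range (k + 1), RatFunc.X ^ i * rowAct P v RatFunc.X u i a = 0 := by
    intro i hi
    rcases Nat.lt_succ_iff_lt_or_eq.mp (Finset.mem_range.mp hi) with h | rfl
    · rw [hu i h, mul_zero]
    · rw [rowAct, Finset.sum_eq_zero, mul_zero]
      intro b _
      rw [coreRow_eq_zero (hP a b) hvk (Nat.lt_succ_self _), pair_zero_left, mul_zero, sub_zero,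
        ← pair_C_mul_left, ← pair_add_left, add_comm, coreRow_add_eq_zero (hP a b) hvk,
        pair_zero_left]
  have hsum := Finset.sum_eq_zero hall
  simp only [rowAct, Finset.mul_sum] at hsum
  rw [Finset.sum_comm] at hsum
  rw [Pi.zero_apply, ← hsum]
  simp only [Matrix.mulVec, dotProduct, toRat, Matrix.map_apply]
  refine Finset.sum_congr rfl fun b _ => ?_
  have := ansatzRow_mulVec ω u b
  simp only [Matrix.mulVec, dotProduct, toRat, Matrix.map_apply] at this
  rw [this, algebraMap_ratFunc_eq_sum (hP a b), Finset.sum_mul]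
  have htel := Finset.sum_range_sub' (fun i => (RatFunc.X : RatFunc F) ^ i *
    pair (coreRow (P a b) v i) (fun c => u (c, b))) (k + 1)
  simp only [coreRow_zero, pair_zero_left, coreRow_eq_zero (hP a b) hvk (Nat.lt_succ_self _),
    mul_zero, sub_zero] at htel
  rw [← sub_eq_zero, ← Finset.sum_sub_distrib, ← neg_eq_zero, ← Finset.sum_neg_distrib, ← htel]
  refine Finset.sum_congr rfl fun i _ => ?_
  rw [Algebra.smul_def]
  ring

/-! ### The kernel of the ansatz map is spanned by constant vectors -/

/-- If every `F`-linear functional `K → F` sends the coordinates of `u` into the set `W`, then `u` is a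
`K`-combination of vectors of `W`: expand the coordinates in an `F`-basis of `K`. -/
theorem mem_span_of_dual {K ι : Type*} [Field K] [Algebra F K] [Finite ι] (W : Set (ι → F))
    (u : ι → K) (h : ∀ f : K →ₗ[F] F, (fun x => f (u x)) ∈ W) :
    u ∈ Submodule.span K ((fun w x => algebraMap F K (w x)) '' W) := by
  classical
  cases nonempty_fintype ι
  let β := Module.Free.chooseBasis F K
  let S := Finset.univ.biUnion fun x => (β.repr (u x)).support
  have : u = ∑ t ∈ S, β t • fun x => algebraMap F K (β.repr (u x) t) := by
    ext x
    conv_lhs => rw [← β.linearCombination_repr (u x), Finsupp.linearCombination_apply]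
    rw [Finsupp.sum_of_support_subset (s := S) _
      (Finset.subset_biUnion_of_mem (fun x => (β.repr (u x)).support) (Finset.mem_univ x))]
    · simp [Algebra.smul_def, mul_comm]
    · simp
  rw [this]
  refine Submodule.sum_mem _ fun t _ => Submodule.smul_mem _ _ (Submodule.subset_span ?_)
  exact ⟨_, h (β.coord t), rfl⟩

theorem linearIndependent_map_algebraMap {K ι τ : Type*} [Field K] [Algebra F K] [Finite τ]
    {w : τ → ι → F} (hw : LinearIndependent F w) :
    LinearIndependent K (fun t x => algebraMap F K (w t x)) := by
  cases nonempty_fintype τ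
  rw [Fintype.linearIndependent_iff] at hw ⊢
  intro g hg t
  rw [← Module.forall_dual_apply_eq_zero_iff F]
  intro f
  refine hw (fun t => f (g t)) ?_ t
  ext x
  have h := congrArg f (congrFun hg x)
  simp only [Finset.sum_apply, Pi.smul_apply, smul_eq_mul, mul_comm (g _), ← Algebra.smul_def,
    map_sum, map_smul, Pi.zero_apply, map_zero] at h
  simpa only [Finset.sum_apply, Pi.smul_apply, smul_eq_mul, mul_comm, Pi.zero_apply] using h

/-- On the kernel of the ansatz map the pencil acts as `(y - z)` times the core, so a kernel vector of
the pencil is annihilated by the constant matrix of the core. -/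
theorem sum_pair_coreRow_eq_zero {m n k : ℕ} {P : Matrix (Fin m) (Fin n) F[X]} {v : F[X]}
    {u : Fin k × Fin n → RatFunc F} (hu : u ∈ ratKer (DL k P v))
    (hv : ∀ b, pair v (fun c => u (c, b)) = 0) (a : Fin m) {i : ℕ} (hi : i ≤ k) :
    ∑ b, pair (coreRow (P a b) v i) (fun c => u (c, b)) = 0 := by
  rw [mem_ratKer_DL] at hu
  induction i with
  | zero => simp
  | succ i ih =>
    have h := hu i (by omega) a
    simp only [rowAct, hv, smul_zero, zero_add, Finset.sum_sub_distrib, ih (by omega),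
      ← Finset.mul_sum, zero_sub, neg_eq_zero, mul_eq_zero, RatFunc.X_ne_zero, false_or] at h
    exact h

/-- The part of the kernel of the pencil that the ansatz map kills is spanned over `F(z)` by constant
vectors, being the kernel of a constant matrix. -/
theorem mem_span_constants {m n k : ℕ} {P : Matrix (Fin m) (Fin n) F[X]} {v : F[X]}
    {u : Fin k × Fin n → RatFunc F} (hu : u ∈ ratKer (DL k P v))
    (hv : ∀ b, pair v (fun c => u (c, b)) = 0) :
    u ∈ Submodule.span (RatFunc F) ((fun w x => algebraMap F (RatFunc F) (w x)) ''
      {w : Fin k × Fin n → F | (fun x => algebraMap F (RatFunc F) (w x)) ∈ ratKer (DL k P v) ∧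
        ∀ b, pair v (fun c => w (c, b)) = 0}) := by
  refine mem_span_of_dual _ u fun f => ⟨?_, fun b => ?_⟩
  · have key (i : ℕ) (hi : i ≤ k) (a : Fin m) : ∑ b, pair (coreRow (P a b) v i)
        (fun c => algebraMap F (RatFunc F) (f (u (c, b)))) = 0 := by
      have := congrArg f (sum_pair_coreRow_eq_zero hu hv a hi)
      rw [map_sum, map_zero] at this
      have h2 := congrArg (Algebra.linearMap F (RatFunc F)) this
      rw [map_sum, map_zero] at h2
      simpa [map_pair] using h2
    rw [mem_ratKer_DL]
    intro i hi a
    have h0 (b) : pair v (fun c => algebraMap F (RatFunc F) (f (u (c, b)))) = 0 := by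
      have := congrArg (Algebra.linearMap F (RatFunc F)) (congrArg f (hv b))
      simpa [map_pair] using this
    simp only [rowAct, h0, smul_zero, zero_add, Finset.sum_sub_distrib, key i hi.le,
      ← Finset.mul_sum, key (i + 1) hi, mul_zero, sub_zero]
  · rw [← map_pair, hv, map_zero]

/-! ### Lifting kernel vectors of the matrix polynomial -/

/-- A substitute for `h ↦ Res (x ^ (-e-1) h / v)`. Only its values on multiples of `v` matter, so any
linear left inverse of multiplication by `v` will do. -/
theorem exists_functional_mul {v : F[X]} (hv : v ≠ 0) (e : ℕ) :
    ∃ ρ : F[X] →ₗ[F] F, ∀ h, ρ (v * h) = h.coeff e := by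
  obtain ⟨g, hg⟩ := (LinearMap.mulLeft F v).exists_leftInverse_of_injective
    (LinearMap.ker_eq_bot.mpr (mul_right_injective₀ hv))
  refine ⟨(lcoeff F e).comp g, fun h => ?_⟩
  have := LinearMap.congr_fun hg h
  simp only [LinearMap.comp_apply, LinearMap.mulLeft_apply, LinearMap.id_apply] at this
  simp [this]

/-- The lift of a polynomial `f` of degree at most `e` to a block vector. When `ρ (v h)` is the
coefficient of `x ^ e` in `h`, as in `exists_functional_mul`, this is the functional
`q ↦ Res (q(x) f(x) / ((x - z) v(x)))` with `1 / (x - z) = ∑ z ^ j x ^ (-j-1)` cut off after `j = e`;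
the powers of `x` are shifted by `e + 1` to stay within polynomials. -/
def liftVec (k e : ℕ) (ρ : F[X] →ₗ[F] F) (f : F[X]) (c : Fin k) : F[X] :=
  ∑ j ∈ Finset.range (e + 1), X ^ j * C (ρ (X ^ (k - 1 - (c : ℕ)) * (X ^ (e - j) * f)))

theorem natDegree_liftVec_le (k e : ℕ) (ρ : F[X] →ₗ[F] F) (f : F[X]) (c : Fin k) :
    (liftVec k e ρ f c).natDegree ≤ e := by
  refine natDegree_sum_le_of_forall_le _ _ fun j hj => ?_
  rw [mul_comm]
  exact (natDegree_C_mul_X_pow_le _ _).trans (by simpa [Nat.lt_succ_iff] using hj)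

theorem sum_coeff_rev_mul_X_pow {k : ℕ} {q : F[X]} (hq : ∀ l, k ≤ l → q.coeff l = 0) :
    ∑ c : Fin k, C (q.coeff (k - 1 - (c : ℕ))) * X ^ (k - 1 - (c : ℕ)) = q := by
  rw [Fin.sum_univ_eq_sum_range (fun c => C (q.coeff (k - 1 - c)) * X ^ (k - 1 - c)),
    Finset.sum_range_reflect (fun l => C (q.coeff l) * X ^ l)]
  ext l
  simp only [finsetSum_coeff, coeff_C_mul_X_pow, Finset.sum_ite_eq, Finset.mem_range]
  split_ifs with h
  · rfl
  · exact (hq l (by omega)).symm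

theorem pair_liftVec {k e : ℕ} {q : F[X]} (hq : ∀ l, k ≤ l → q.coeff l = 0)
    (ρ : F[X] →ₗ[F] F) (f : F[X]) :
    pair q (liftVec k e ρ f) =
      ∑ j ∈ Finset.range (e + 1), X ^ j * C (ρ (X ^ (e - j) * (q * f))) := by
  simp only [pair, liftVec, Finset.smul_sum]
  rw [Finset.sum_comm]
  refine Finset.sum_congr rfl fun j _ => ?_
  conv_rhs => rw [← sum_coeff_rev_mul_X_pow hq]
  rw [Finset.sum_mul, Finset.mul_sum, map_sum, map_sum, Finset.mul_sum]
  refine Finset.sum_congr rfl fun c _ => ?_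
  rw [show X ^ (e - j) * (C (q.coeff (k - 1 - (c : ℕ))) * X ^ (k - 1 - (c : ℕ)) * f) =
    q.coeff (k - 1 - (c : ℕ)) • (X ^ (k - 1 - (c : ℕ)) * (X ^ (e - j) * f)) by
      rw [smul_eq_C_mul]; ring, map_smul, smul_eq_mul, C_mul, smul_eq_C_mul]
  ring

theorem sum_X_pow_mul_coeff_X_pow_mul {e : ℕ} {f : F[X]} (hf : f.natDegree ≤ e) :
    ∑ j ∈ Finset.range (e + 1), X ^ j * C ((X ^ (e - j) * f).coeff e) = f := by
  conv_rhs => rw [as_sum_range_C_mul_X_pow' f (Nat.lt_succ_of_le hf)]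
  refine Finset.sum_congr rfl fun j hj => ?_
  have hj : j ≤ e := by simpa [Nat.lt_succ_iff] using hj
  rw [coeff_X_pow_mul', if_pos (Nat.sub_le _ _), Nat.sub_sub_self hj, mul_comm]

theorem pair_liftVec_self {k e : ℕ} {v : F[X]} (hv : v.natDegree < k) {ρ : F[X] →ₗ[F] F}
    (hρ : ∀ h, ρ (v * h) = h.coeff e) {f : F[X]} (hf : f.natDegree ≤ e) :
    pair v (liftVec k e ρ f) = f := by
  rw [pair_liftVec (fun l hl => coeff_eq_zero_of_natDegree_lt (by omega))]
  simp only [mul_left_comm _ v, hρ]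
  exact sum_X_pow_mul_coeff_X_pow_mul hf

/-- If `∑ p_b f_b = 0`, then `∑ core(p_b, v) f_b(x) = v(x) ∑ p_b(y) f_b(x) / (x - y)`; coefficientwise
in `y`, this is a multiple of `v` with a cofactor of degree less than `e`. -/
theorem exists_sum_coreRow_mul_eq {n k e : ℕ} {p f : Fin n → F[X]} {v : F[X]}
    (hp : ∀ b, (p b).natDegree ≤ k) (hv : v.natDegree < k) (hv0 : v ≠ 0)
    (hf : ∀ b, (f b).natDegree ≤ e) (hpf : ∑ b, p b * f b = 0) (i : ℕ) :
    ∃ t : F[X], ∑ b, coreRow (p b) v i * f b = v * t ∧ ∀ l, e ≤ l → t.coeff l = 0 := by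
  have hrec (i : ℕ) : X * ∑ b, coreRow (p b) v (i + 1) * f b =
      ∑ b, coreRow (p b) v i * f b + v * ∑ b, C ((p b).coeff i) * f b := by
    have : C (v.coeff i) * ∑ b, p b * f b = 0 := by rw [hpf, mul_zero]
    rw [← sub_zero (∑ b, coreRow (p b) v i * f b + _), ← this]
    simp only [Finset.mul_sum, ← Finset.sum_add_distrib, ← Finset.sum_sub_distrib]
    refine Finset.sum_congr rfl fun b _ => ?_
    rw [← mul_assoc, X_mul_coreRow_succ]
    ring
  -- Divisibility propagates downwards from the rows that vanish.
  have hdvd (d : ℕ) : ∀ i, k + 1 ≤ i + d → v ∣ ∑ b, coreRow (p b) v i * f b := by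
    induction d with
    | zero =>
      intro i hi
      rw [Finset.sum_eq_zero fun b _ => by rw [coreRow_eq_zero (hp b) hv (by omega), zero_mul]]
      exact dvd_zero _
    | succ d ih =>
      intro i hi
      rw [← dvd_add_left (dvd_mul_right v _), ← hrec]
      exact (ih (i + 1) (by omega)).mul_left _
  obtain ⟨t, ht⟩ := hdvd (k + 1) i (by omega)
  refine ⟨t, ht, ?_⟩
  clear hpf
  -- The degree bound propagates upwards from row zero.
  induction i generalizing t with
  | zero =>
    have : t = 0 := by simpa [hv0] using ht.symm
    simp [this]
  | succ i ih =>
    obtain ⟨s, hs⟩ := hdvd (k + 1) i (by omega)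
    have h := hrec i
    rw [ht, hs, ← mul_add, mul_left_comm] at h
    have h := mul_left_cancel₀ hv0 h
    intro l hl
    have h := congrArg (fun q => q.coeff (l + 1)) h
    simp only [coeff_X_mul, coeff_add, finsetSum_coeff, coeff_C_mul] at h
    rw [h, ih s hs _ (by omega), zero_add, Finset.sum_eq_zero]
    intro b _
    rw [coeff_eq_zero_of_natDegree_lt (Nat.lt_succ_of_le ((hf b).trans hl)), mul_zero]

/-- The lift of a kernel vector of `P` is a kernel vector of the pencil. The sums over `j` telescope,
and the two end terms are coefficients, in `x ^ e`, of `x ^ (e + 1) t` and of `t`, where `v t` is the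
row of the core applied to `f` and `t` has degree less than `e`. -/
theorem rowAct_liftVec {m n k e : ℕ} {P : Matrix (Fin m) (Fin n) F[X]} (hP : HasGrade k P)
    {v : F[X]} (hv : v.natDegree < k) (hv0 : v ≠ 0) {ρ : F[X] →ₗ[F] F}
    (hρ : ∀ h, ρ (v * h) = h.coeff e) {f : Fin n → F[X]} (hf : ∀ b, (f b).natDegree ≤ e)
    (hPf : P.mulVec f = 0) (i : ℕ) (a : Fin m) :
    rowAct P v X (fun x : Fin k × Fin n => liftVec k e ρ (f x.2) x.1) i a = 0 := by
  obtain ⟨t, ht, htl⟩ := exists_sum_coreRow_mul_eq (hP a) hv hv0 hf (congrFun hPf a) (i + 1)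
  have hrow (i : ℕ) : ∑ b, pair (coreRow (P a b) v i) (liftVec k e ρ (f b)) =
      ∑ j ∈ Finset.range (e + 1),
        X ^ j * C (ρ (X ^ (e - j) * ∑ b, coreRow (P a b) v i * f b)) := by
    simp only [pair_liftVec (fun l hl => coreRow_coeff_eq_zero (hP a _) hv i hl)]
    rw [Finset.sum_comm]
    simp only [Finset.mul_sum, map_sum]
  have hg : ∑ b, (P a b).coeff i • f b = ∑ j ∈ Finset.range (e + 1),
      X ^ j * C (ρ (X ^ (e - j) * (v * ∑ b, (P a b).coeff i • f b))) := by
    simp only [mul_left_comm _ v, hρ]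
    refine (sum_X_pow_mul_coeff_X_pow_mul ?_).symm
    exact natDegree_sum_le_of_forall_le _ _ fun b _ => (natDegree_smul_le _ _).trans (hf b)
  have hS : v * (∑ b, (P a b).coeff i • f b) + ∑ b, coreRow (P a b) v i * f b = X * (v * t) := by
    have h0 : C (v.coeff i) * ∑ b, P a b * f b = 0 := by
      rw [show ∑ b, P a b * f b = 0 from congrFun hPf a, mul_zero]
    rw [← ht, ← sub_zero (_ + _), ← h0]
    simp only [Finset.mul_sum, ← Finset.sum_add_distrib, ← Finset.sum_sub_distrib]
    refine Finset.sum_congr rfl fun b _ => ?_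
    rw [← mul_assoc X, X_mul_coreRow_succ, smul_eq_C_mul]
    ring
  simp only [rowAct, pair_liftVec_self hv hρ (hf _), Finset.sum_sub_distrib,
    Finset.sum_add_distrib, ← Finset.mul_sum]
  rw [hrow, hrow, hg, ht, ← Finset.sum_add_distrib]
  simp only [← mul_add, ← map_add, hS]
  rw [Finset.mul_sum, ← Finset.sum_sub_distrib]
  have hρt (s : ℕ) (hs : s = 0 ∨ s = e + 1) : ρ (X ^ s * (v * t)) = 0 := by
    rw [mul_left_comm, hρ]
    rcases hs with rfl | rfl
    · simpa using htl e le_rfl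
    · rw [coeff_X_pow_mul', if_neg (by omega)]
  have htel := Finset.sum_range_sub' (fun j => (X : F[X]) ^ j *
    C (ρ (X ^ (e + 1 - j) * (v * t)))) (e + 1)
  simp only [Nat.sub_self, Nat.sub_zero, hρt _ (Or.inl rfl), hρt _ (Or.inr rfl), C_0, mul_zero,
    sub_zero] at htel
  rw [← htel]
  refine Finset.sum_congr rfl fun j hj => ?_
  have hj : j ≤ e := by simpa [Nat.lt_succ_iff] using hj
  rw [show e + 1 - (j + 1) = e - j by omega, show e + 1 - j = (e - j) + 1 by omega]
  ring_nf

theorem map_rowAct {m n k : ℕ} (P : Matrix (Fin m) (Fin n) F[X]) (v : F[X])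
    {A B : Type*} [CommRing A] [Algebra F A] [CommRing B] [Algebra F B] (φ : A →ₐ[F] B)
    (z : A) (u : Fin k × Fin n → A) (i : ℕ) (a : Fin m) :
    φ (rowAct P v z u i a) = rowAct P v (φ z) (fun x => φ (u x)) i a := by
  simp only [rowAct, map_sum, map_sub, map_add, map_mul, map_smul]
  have (q : F[X]) (w : Fin k → A) : φ (pair q w) = pair q fun c => φ (w c) :=
    map_pair φ.toLinearMap q w
  simp only [this]

/-- Every polynomial vector in the kernel of `P` is the image, under the ansatz map, of a polynomial
vector in the kernel of the pencil whose degree is no larger. -/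
theorem exists_lift {m n k e : ℕ} (hk : 0 < k) {P : Matrix (Fin m) (Fin n) F[X]}
    (hP : HasGrade k P) {ω : Fin k → F} (hω : ω ≠ 0) {f : Fin n → F[X]}
    (hf : ∀ b, (f b).natDegree ≤ e)
    (hPf : (fun b => algebraMap F[X] (RatFunc F) (f b)) ∈ ratKer P) :
    ∃ u : Fin k × Fin n → F[X], (∀ x, (u x).natDegree ≤ e) ∧
      (fun x => algebraMap F[X] (RatFunc F) (u x)) ∈ ratKer (DL k P (ansatzPoly ω)) ∧
      (toRat (constPoly (ansatzRow ω n))).mulVec (fun x => algebraMap F[X] (RatFunc F) (u x)) =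
        fun b => algebraMap F[X] (RatFunc F) (f b) := by
  have hv0 := ansatzPoly_ne_zero hω
  have hv := natDegree_ansatzPoly_lt hk ω
  obtain ⟨ρ, hρ⟩ := exists_functional_mul hv0 e
  have hPf' : P.mulVec f = 0 := by
    ext1 a
    apply IsFractionRing.injective F[X] (RatFunc F)
    rw [RingHom.map_mulVec]
    rw [Pi.zero_apply, map_zero]
    exact congrFun (LinearMap.mem_ker.mp hPf) a
  let φ : F[X] →ₐ[F] RatFunc F := IsScalarTower.toAlgHom F F[X] (RatFunc F)
  refine ⟨fun x => liftVec k e ρ (f x.2) x.1, fun x => natDegree_liftVec_le .., ?_, ?_⟩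
  · rw [mem_ratKer_DL]
    intro i _ a
    have := congrArg φ (rowAct_liftVec hP hv hv0 hρ hf hPf' i a)
    rw [map_rowAct, map_zero] at this
    simpa [φ] using this
  · ext b
    rw [ansatzRow_mulVec]
    have := map_pair φ.toLinearMap (ansatzPoly ω) (liftVec k e ρ (f b))
    rw [pair_liftVec_self hv hρ (hf b)] at this
    exact this.symm

/-! ### Polynomial bases and column degrees -/

theorem IsPolyBasis.submatrix {ι κ τ τ' : Type*} [Fintype κ] {P : Matrix ι κ F[X]}
    {A : Matrix κ τ F[X]} (hA : IsPolyBasis P A) (e : τ' ≃ τ) :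
    IsPolyBasis P (A.submatrix id e) := by
  have h : (toRat (A.submatrix id e)).col = (toRat A).col ∘ e := rfl
  rw [IsPolyBasis, h, linearIndependent_equiv, e.surjective.range_comp]
  exact hA

theorem IsPolyBasis.card_eq {ι κ σ τ : Type*} [Fintype κ] [Fintype σ] [Fintype τ]
    {P : Matrix ι κ F[X]} {A : Matrix κ σ F[X]} {B : Matrix κ τ F[X]}
    (hA : IsPolyBasis P A) (hB : IsPolyBasis P B) : Fintype.card σ = Fintype.card τ := by
  rw [← finrank_span_eq_card hA.1, ← finrank_span_eq_card hB.1, hA.2, hB.2]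

theorem sum_colDegree_submatrix {κ τ τ' : Type*} [Fintype κ] [Fintype τ] [Fintype τ']
    (A : Matrix κ τ F[X]) (e : τ' ≃ τ) :
    ∑ j, colDegree (A.submatrix id e) j = ∑ j, colDegree A j :=
  Equiv.sum_comp e (colDegree A)

theorem IsMinimalBasis.sum_le {ι κ σ τ : Type*} [Fintype κ] [Fintype σ] [Fintype τ]
    {P : Matrix ι κ F[X]} {A : Matrix κ σ F[X]} {B : Matrix κ τ F[X]}
    (hA : IsMinimalBasis P A) (hB : IsPolyBasis P B) : ∑ j, colDegree A j ≤ ∑ j, colDegree B j := by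
  let e := Fintype.equivOfCardEq (hA.1.card_eq hB)
  rw [← sum_colDegree_submatrix B e]
  exact hA.2 _ (hB.submatrix e)

theorem IsMinimalBasis.submatrix {ι κ τ τ' : Type*} [Fintype κ] [Fintype τ] [Fintype τ']
    {P : Matrix ι κ F[X]} {A : Matrix κ τ F[X]} (hA : IsMinimalBasis P A) (e : τ' ≃ τ) :
    IsMinimalBasis P (A.submatrix id e) := by
  refine ⟨hA.1.submatrix e, fun B hB => ?_⟩
  rw [sum_colDegree_submatrix]
  exact hA.sum_le hB

theorem IsPolyBasis.col_mem {ι κ τ : Type*} [Fintype κ] {P : Matrix ι κ F[X]}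
    {A : Matrix κ τ F[X]} (hA : IsPolyBasis P A) (j : τ) : (toRat A).col j ∈ ratKer P :=
  hA.2 ▸ Submodule.subset_span ⟨j, rfl⟩

theorem natDegree_le_colDegree {κ τ : Type*} [Fintype κ] (A : Matrix κ τ F[X]) (i : κ) (j : τ) :
    (A i j).natDegree ≤ colDegree A j :=
  Finset.le_sup (f := fun i => (A i j).natDegree) (Finset.mem_univ i)

theorem colDegree_constPoly {κ τ : Type*} [Fintype κ] (A : Matrix κ τ F) (j : τ) :
    colDegree (constPoly A) j = 0 := by
  simp [colDegree, constPoly]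

theorem colDegree_constPoly_mul_le {κ κ' τ : Type*} [Fintype κ] [Fintype κ'] (A : Matrix κ' κ F)
    (B : Matrix κ τ F[X]) (j : τ) : colDegree (constPoly A * B) j ≤ colDegree B j := by
  refine Finset.sup_le fun i _ => natDegree_sum_le_of_forall_le _ _ fun x _ => ?_
  exact (natDegree_C_mul_le _ _).trans (natDegree_le_colDegree B x j)

/-! ### Comparison of the two kernels -/

/-- A minimal basis of the pencil has degree sum at most that of any polynomial basis of `P`: lifts of
the latter, together with constant vectors killed by the ansatz map, form a basis of the kernel of the
pencil. -/
theorem sum_colDegree_pencil_le {m n k : ℕ} (hk : 0 < k) {P : Matrix (Fin m) (Fin n) F[X]}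
    (hP : HasGrade k P) {ω : Fin k → F} (hω : ω ≠ 0) {τ σ : Type*} [Fintype τ] [Fintype σ]
    {N : Matrix (Fin k × Fin n) τ F[X]} (hN : IsMinimalBasis (DL k P (ansatzPoly ω)) N)
    {B : Matrix (Fin n) σ F[X]} (hB : IsPolyBasis P B) :
    ∑ j, colDegree N j ≤ ∑ j, colDegree B j := by
  let Ψ := (toRat (constPoly (ansatzRow ω n))).mulVecLin
  have hΨ (u) (b : Fin n) : Ψ u b = pair (ansatzPoly ω) (fun c => u (c, b)) := ansatzRow_mulVec ω u b
  choose u hdeg hker hlift using fun j => exists_lift hk hP hω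
    (f := fun b => B b j) (natDegree_le_colDegree B · j) (hB.col_mem j)
  replace hlift (j : σ) : Ψ (fun x => algebraMap F[X] (RatFunc F) (u j x)) = (toRat B).col j :=
    hlift j
  obtain ⟨s, hs, hspan, hli⟩ := exists_linearIndependent (RatFunc F)
    ((fun (w : Fin k × Fin n → F) x => algebraMap F (RatFunc F) (w x)) ''
      {w | (fun x => algebraMap F (RatFunc F) (w x)) ∈ ratKer (DL k P (ansatzPoly ω)) ∧
        ∀ b, pair (ansatzPoly ω) (fun c => w (c, b)) = 0})
  have : Fintype s := hli.setFinite.fintype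
  choose w hw hws using fun t : s => hs t.2
  have hΨs (t : s) : Ψ t = 0 := by
    ext b
    have := congrArg (Algebra.linearMap F (RatFunc F)) ((hw t).2 b)
    rw [map_pair, map_zero] at this
    rw [hΨ, ← hws t]
    exact this
  let D : Matrix (Fin k × Fin n) (σ ⊕ s) F[X] :=
    Matrix.fromCols (Matrix.of fun x j => u j x) (constPoly (Matrix.of fun x t => w t x))
  have hD : (toRat D).col =
      Sum.elim (fun j x => algebraMap F[X] (RatFunc F) (u j x)) (fun t : s => (t : _ → RatFunc F)) := by
    ext j x
    rcases j with j | t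
    · rfl
    · have := congrFun (hws t) x
      simp only [Sum.elim_inr]
      rw [← this]
      simp [D, toRat, constPoly, Matrix.col, RatFunc.algebraMap_eq_C]
  have hDb : IsPolyBasis (DL k P (ansatzPoly ω)) D := by
    rw [IsPolyBasis, hD]
    constructor
    · have hBli := Fintype.linearIndependent_iff.mp hB.1
      have hsli := Fintype.linearIndependent_iff.mp hli
      rw [Fintype.linearIndependent_iff]
      intro g hg
      simp only [Fintype.sum_sum_type, Sum.elim_inl, Sum.elim_inr] at hg
      have h1 : ∀ j, g (Sum.inl j) = 0 := by
        refine hBli (fun j => g (Sum.inl j)) ?_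
        have := congrArg Ψ hg
        simpa only [map_add, map_sum, map_smul, hlift, hΨs, smul_zero, Finset.sum_const_zero,
          add_zero, map_zero] using this
      have h2 := hsli (fun t => g (Sum.inr t)) (by simpa [h1] using hg)
      rintro (j | t)
      exacts [h1 j, h2 t]
    · apply le_antisymm
      · rw [Submodule.span_le]
        rintro _ ⟨j | t, rfl⟩
        · exact hker j
        · have := (hw t).1
          rw [SetLike.mem_coe, Sum.elim_inr, ← hws t]
          exact this
      · intro y hy
        have hPy : Ψ y ∈ ratKer P := ansatzRow_mulVec_mem_ratKer hk hP ω hy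
        rw [← hB.2, Submodule.mem_span_range_iff_exists_fun] at hPy
        obtain ⟨g, hg⟩ := hPy
        set y' := ∑ j, g j • fun x => algebraMap F[X] (RatFunc F) (u j x) with hy'
        have hΨy : Ψ (y - y') = 0 := by
          rw [map_sub, hy', map_sum]
          simp only [map_smul, hlift, hg, sub_self]
        have hmem : y - y' ∈ ratKer (DL k P (ansatzPoly ω)) :=
          Submodule.sub_mem _ hy (Submodule.sum_mem _ fun j _ => Submodule.smul_mem _ _ (hker j))
        have hc := mem_span_constants hmem fun b => by rw [← hΨ, hΨy, Pi.zero_apply]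
        rw [← hspan] at hc
        rw [← sub_add_cancel y y', Set.Sum.elim_range, Subtype.range_coe]
        refine Submodule.add_mem _ (Submodule.span_mono Set.subset_union_right hc) ?_
        refine Submodule.sum_mem _ fun j _ => Submodule.smul_mem _ _ (Submodule.subset_span ?_)
        exact Or.inl ⟨j, rfl⟩
  refine (hN.sum_le hDb).trans ?_
  rw [Fintype.sum_sum_type]
  have h1 (t : s) : colDegree D (Sum.inr t) = 0 :=
    colDegree_constPoly (Matrix.of fun x t => w t x) t
  simp only [h1, Finset.sum_const_zero, add_zero]
  exact Finset.sum_le_sum fun j _ => Finset.sup_le fun x _ => hdeg j x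

theorem map_ratKer_DL {m n k : ℕ} (hk : 0 < k) {P : Matrix (Fin m) (Fin n) F[X]}
    (hP : HasGrade k P) {ω : Fin k → F} (hω : ω ≠ 0) :
    (ratKer (DL k P (ansatzPoly ω))).map (toRat (constPoly (ansatzRow ω n))).mulVecLin =
      ratKer P := by
  apply le_antisymm
  · rintro _ ⟨u, hu, rfl⟩
    exact ansatzRow_mulVec_mem_ratKer hk hP ω hu
  · intro g hg
    obtain ⟨q, hq⟩ := IsLocalization.exist_integer_multiples_of_finite (nonZeroDivisors F[X]) g
    choose f hf using hq
    have hfg : (fun b => algebraMap F[X] (RatFunc F) (f b)) =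
        algebraMap F[X] (RatFunc F) q • g := by
      ext b
      rw [hf, Pi.smul_apply, Algebra.smul_def, smul_eq_mul]
    obtain ⟨u, -, hu, hu'⟩ := exists_lift hk hP hω (f := f)
      (e := Finset.univ.sup fun b => (f b).natDegree)
      (fun b => Finset.le_sup (f := fun b => (f b).natDegree) (Finset.mem_univ b))
      (hfg ▸ Submodule.smul_mem _ _ hg)
    have hq0 : algebraMap F[X] (RatFunc F) q ≠ 0 :=
      IsFractionRing.to_map_ne_zero_of_mem_nonZeroDivisors q.2
    rw [← inv_smul_smul₀ hq0 g, ← hfg, ← hu']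
    exact Submodule.smul_mem _ _ (Submodule.mem_map_of_mem hu)

/-! ### Exchanging constant columns -/

theorem col_constPoly {κ τ : Type*} (B : Matrix κ τ F) (j : τ) :
    (toRat (constPoly B)).col j = fun i => algebraMap F (RatFunc F) (B.col j i) := by
  ext i
  simp [toRat, constPoly, Matrix.col, RatFunc.algebraMap_eq_C]

theorem span_col_constPoly_le {κ σ τ : Type*} {A : Matrix κ σ F} {B : Matrix κ τ F}
    (h : Submodule.span F (Set.range A.col) ≤ Submodule.span F (Set.range B.col)) :
    Submodule.span (RatFunc F) (Set.range (toRat (constPoly A)).col) ≤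
      Submodule.span (RatFunc F) (Set.range (toRat (constPoly B)).col) := by
  let G : (κ → F) →ₗ[F] (κ → RatFunc F) := (Algebra.linearMap F (RatFunc F)).compLeft κ
  have h2 : Submodule.span F (Set.range B.col) ≤ ((Submodule.span (RatFunc F)
      (Set.range (toRat (constPoly B)).col)).restrictScalars F).comap G := by
    rw [Submodule.span_le]
    rintro _ ⟨j, rfl⟩
    exact Submodule.subset_span ⟨j, col_constPoly B j⟩
  rw [Submodule.span_le]
  rintro _ ⟨j, rfl⟩
  rw [col_constPoly]
  exact h2 (h (Submodule.subset_span ⟨j, rfl⟩))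

theorem col_fromCols {κ σ τ : Type*} (A : Matrix κ σ F[X]) (B : Matrix κ τ F[X]) :
    (toRat (Matrix.fromCols A B)).col = Sum.elim (toRat A).col (toRat B).col := by
  ext j i
  rcases j with j | j <;> rfl

theorem span_col_fromCols {κ σ τ : Type*} (A : Matrix κ σ F[X]) (B : Matrix κ τ F[X]) :
    Submodule.span (RatFunc F) (Set.range (toRat (Matrix.fromCols A B)).col) =
      Submodule.span (RatFunc F) (Set.range (toRat A).col) ⊔
        Submodule.span (RatFunc F) (Set.range (toRat B).col) := by
  rw [col_fromCols, Set.Sum.elim_range, Submodule.span_union]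

/-- If the columns of `[A M]` span the kernel of `P`, with `M` constant of independent columns and no
column of `A` of degree zero, and if every basis selected among them has degree sum at least that of
`A`, then they are independent: completing `M` to a basis by some columns of `A` lowers the degree sum
unless all of them are used. -/
theorem isPolyBasis_fromCols {ι κ σ τ : Type*} [Fintype κ] [Fintype σ] [Fintype τ]
    {P : Matrix ι κ F[X]} {A : Matrix κ σ F[X]} {M : Matrix κ τ F}
    (hM : LinearIndependent F M.col)
    (hspan : Submodule.span (RatFunc F) (Set.range (toRat (Matrix.fromCols A (constPoly M))).col) =
      ratKer P)
    (hA : ∀ j, colDegree A j ≠ 0)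
    (hmin : ∀ (s : Set (σ ⊕ τ)) [Fintype s],
      IsPolyBasis P ((Matrix.fromCols A (constPoly M)).submatrix id ((↑) : s → σ ⊕ τ)) →
      ∑ j, colDegree A j ≤ ∑ j : s, colDegree (Matrix.fromCols A (constPoly M)) j) :
    IsPolyBasis P (Matrix.fromCols A (constPoly M)) := by
  classical
  set E := Matrix.fromCols A (constPoly M) with hE
  -- Constant vectors that are independent over `F` remain so over `F(z)`.
  have hind : LinearIndepOn (RatFunc F) (toRat E).col (Set.range Sum.inr) := by
    rw [linearIndepOn_range_iff Sum.inr_injective]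
    have : (toRat E).col ∘ Sum.inr =
        fun (t : τ) i => algebraMap F (RatFunc F) (M.col t i) := by
      ext1 t
      rw [hE, col_fromCols, Function.comp_apply, Sum.elim_inr, col_constPoly]
    rw [this]
    exact linearIndependent_map_algebraMap hM
  obtain ⟨s, -, hs, hspan_s, hli⟩ := exists_linearIndepOn_extension hind (Set.subset_univ _)
  rw [Set.image_univ] at hspan_s
  have hr : Set.range ((toRat (E.submatrix id ((↑) : s → σ ⊕ τ))).col) = (toRat E).col '' s := by
    rw [Set.image_eq_range]
    rfl
  have hbasis : IsPolyBasis P (E.submatrix id ((↑) : s → σ ⊕ τ)) := by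
    refine ⟨hli, ?_⟩
    rw [hr, ← hspan]
    exact le_antisymm (Submodule.span_mono (Set.image_subset_range _ _))
      (Submodule.span_le.mpr hspan_s)
  have hle := hmin s hbasis
  have huniv : s = Set.univ := by
    by_contra hne
    obtain ⟨x, hx⟩ := (Set.ne_univ_iff_exists_notMem s).mp hne
    rcases x with j | t
    · have h1 : ∑ j : s, colDegree E j = ∑ j ∈ s.toFinset, colDegree E j :=
        (Finset.sum_set_coe (f := colDegree E) s)
      have h2 : ∑ j ∈ s.toFinset, colDegree E j < ∑ j, colDegree E j :=
        Finset.sum_lt_sum_of_subset (Finset.subset_univ _) (Finset.mem_univ (Sum.inl j))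
          (by simpa using hx) (Nat.pos_of_ne_zero (hA j)) (fun _ _ _ => Nat.zero_le _)
      have h3 : ∑ j, colDegree E j = ∑ j, colDegree A j := by
        rw [Fintype.sum_sum_type]
        have (t : τ) : colDegree E (Sum.inr t) = 0 := colDegree_constPoly M t
        simp only [this, Finset.sum_const_zero, add_zero]
        rfl
      omega
    · exact hx (hs ⟨t, rfl⟩)
  subst huniv
  exact ⟨linearIndepOn_univ_iff.mp hli, hspan⟩

theorem exists_matrix_col_basis {κ σ : Type*} [Finite κ] (M : Matrix κ σ F) :
    ∃ (b : ℕ) (B : Matrix κ (Fin b) F), LinearIndependent F B.col ∧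
      Submodule.span F (Set.range B.col) = Submodule.span F (Set.range M.col) := by
  obtain ⟨s, -, hspan, hli⟩ := exists_linearIndependent F (Set.range M.col)
  have : Fintype s := hli.setFinite.fintype
  let e := (Fintype.equivFin s).symm
  have hcol : (Matrix.of fun i j => (e j : κ → F) i).col = ((↑) : s → κ → F) ∘ e := rfl
  refine ⟨_, Matrix.of fun i j => (e j : κ → F) i, ?_, ?_⟩
  · rw [hcol]
    exact hli.comp e e.injective
  · rw [hcol, e.surjective.range_comp, Subtype.range_coe, hspan]

theorem colDegree_ne_zero {κ τ : Type*} [Fintype κ] {A : Matrix κ τ F[X]} {j : τ}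
    (h : ¬ ∃ u : κ → F, ∀ i, A i j = C (u i)) : colDegree A j ≠ 0 := by
  contrapose! h
  exact ⟨fun i => (A i j).coeff 0, fun i =>
    eq_C_of_natDegree_le_zero ((natDegree_le_colDegree A i j).trans h.le)⟩

end DLRecovery

end

theorem theorem6p3 {F : Type*} [Field F] [IsAlgClosed F] [CharZero F]
    {m n k : ℕ} (hk : 2 ≤ k)
    (P : Matrix (Fin m) (Fin n) F[X]) (hP : DLRecovery.HasGrade k P)
    (ω : Fin k → F) (hω : ω ≠ 0)
    (hdisj : Disjoint (DLRecovery.eigenvalues k P)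
      (DLRecovery.gradedRoots (k - 1) (DLRecovery.ansatzPoly ω)))
    {q : ℕ} (N : Matrix (Fin k × Fin n) (Fin q) F[X])
    (hN : DLRecovery.IsMinimalBasis (DLRecovery.DL k P (DLRecovery.ansatzPoly ω)) N)
    {d c : ℕ} (Md : Matrix (Fin n) (Fin d) F[X]) (Mc : Matrix (Fin n) (Fin c) F)
    (e : Fin d ⊕ Fin c ≃ Fin q)
    (hsplit : (DLRecovery.constPoly (DLRecovery.ansatzRow ω n) * N).submatrix id e =
      Matrix.fromCols Md (DLRecovery.constPoly Mc))
    (hMd : ∀ j : Fin d, ¬ ∃ u : Fin n → F, ∀ i, Md i j = C (u i)) :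
    (∀ {b : ℕ} (Mb : Matrix (Fin n) (Fin b) F),
      LinearIndependent F Mb.col →
      Submodule.span F (Set.range Mb.col) = Submodule.span F (Set.range Mc.col) →
      DLRecovery.IsMinimalBasis P (Matrix.fromCols Md (DLRecovery.constPoly Mb))) ∧
    (DLRecovery.IsMinimalBasis P Md ↔ Mc = 0) := by
  have hk0 : 0 < k := by omega
  have hspan : Submodule.span (RatFunc F)
      (Set.range (DLRecovery.toRat (Matrix.fromCols Md (DLRecovery.constPoly Mc))).col) =
      DLRecovery.ratKer P := by
    rw [← DLRecovery.map_ratKer_DL hk0 hP hω, ← hN.1.2, Submodule.map_span, ← Set.range_comp,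
      ← hsplit]
    congr 1
    rw [← e.surjective.range_comp]
    congr 1
    ext j i
    change DLRecovery.toRat (DLRecovery.constPoly (DLRecovery.ansatzRow ω n) * N) i (e j) =
      (DLRecovery.toRat (DLRecovery.constPoly (DLRecovery.ansatzRow ω n)) *
        DLRecovery.toRat N) i (e j)
    rw [DLRecovery.toRat, Matrix.map_mul]
    rfl
  -- A constant matrix does not raise column degrees, and the columns in `Mc` are dropped.
  have hdeg : ∑ j, DLRecovery.colDegree Md j ≤ ∑ j, DLRecovery.colDegree N j := by
    rw [← Equiv.sum_comp e, Fintype.sum_sum_type]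
    refine le_add_right (Finset.sum_le_sum fun j _ => ?_)
    refine le_trans (le_of_eq ?_)
      (DLRecovery.colDegree_constPoly_mul_le (DLRecovery.ansatzRow ω n) N (e (Sum.inl j)))
    have h (i) := congrFun (congrFun hsplit i) (Sum.inl j)
    simp only [Matrix.submatrix_apply, id, Matrix.fromCols_apply_inl] at h
    simp only [DLRecovery.colDegree, h]
  have hmin {σ : Type} [Fintype σ] {B : Matrix (Fin n) σ F[X]} (hB : DLRecovery.IsPolyBasis P B) :
      ∑ j, DLRecovery.colDegree Md j ≤ ∑ j, DLRecovery.colDegree B j :=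
    hdeg.trans (DLRecovery.sum_colDegree_pencil_le hk0 hP hω hN hB)
  have main : ∀ {b : ℕ} (Mb : Matrix (Fin n) (Fin b) F), LinearIndependent F Mb.col →
      Submodule.span F (Set.range Mb.col) = Submodule.span F (Set.range Mc.col) →
      DLRecovery.IsMinimalBasis P (Matrix.fromCols Md (DLRecovery.constPoly Mb)) := by
    intro b Mb hMb hMbc
    refine ⟨DLRecovery.isPolyBasis_fromCols hMb ?_ (fun j => DLRecovery.colDegree_ne_zero (hMd j))
      fun s _ hs => hmin hs, fun B hB => ?_⟩
    · rw [← hspan, DLRecovery.span_col_fromCols, DLRecovery.span_col_fromCols,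
        le_antisymm (DLRecovery.span_col_constPoly_le hMbc.le)
          (DLRecovery.span_col_constPoly_le hMbc.ge)]
    · refine le_trans (le_of_eq ?_) (hmin hB)
      have h0 (t : Fin b) : DLRecovery.colDegree (Matrix.fromCols Md (DLRecovery.constPoly Mb))
          (Sum.inr t) = 0 := DLRecovery.colDegree_constPoly Mb t
      rw [Fintype.sum_sum_type]
      simp only [h0, Finset.sum_const_zero, add_zero]
      rfl
  refine ⟨main, fun h => ?_, fun h => ?_⟩
  -- Two bases of the kernel of `P` have the same size, so a basis of the span of `Mc` is empty.
  · obtain ⟨b, Mb, hMb, hspanMb⟩ := DLRecovery.exists_matrix_col_basis Mc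
    have hcard := h.1.card_eq (main Mb hMb hspanMb).1
    rw [Fintype.card_sum, Fintype.card_fin, Fintype.card_fin] at hcard
    obtain rfl : b = 0 := by omega
    rw [Set.range_eq_empty, Submodule.span_empty, eq_comm, Submodule.span_eq_bot] at hspanMb
    ext i j
    exact congrFun (hspanMb _ ⟨j, rfl⟩) i
  · have hb := main (b := 0) (Matrix.of fun _ j => j.elim0) linearIndependent_empty_type (by
      subst h
      rw [Set.range_eq_empty, Submodule.span_empty, eq_comm, Submodule.span_eq_bot]
      rintro _ ⟨j, rfl⟩
      rfl)
    exact hb.submatrix (Equiv.sumEmpty (Fin d) (Fin 0)).symm
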